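/- Let $G$ be a finite simple graph with vertex set $V$, and let $G'$ be the graph obtained from $G$ by adding a whisker at every vertex: $G'$ has the vertices of $G$ together with one new vertex $y_v$ for each $v \in V$, and its edges are the edges of $G$ together with the edges $\{v, y_v\}$ for $v \in V$. Let $K$ be an arbitrary field, let $S = K[x_w : w \in V(G')]$ be the polynomial ring with one variable for each vertex of $G'$, and let $I(G') = (x_w x_{w'} : \{w,w'\} \in E(G')) \subset S$ be the edge ideal of $G'$. Then $I(G')$ is Cohen–Macaulay, i.e. $S/I(G')$ is a Cohen–Macaulay ring: it is Noetherian, and for every maximal ideal $\mathfrak m$ of $R = S/I(G')$ the local ring $R_{\mathfrak m}$ satisfies $\operatorname{depth} R_{\mathfrak m} = \dim R_{\mathfrak m}$. -/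

import Mathlib

namespace SimpleGraph

/-- The edge ideal `I(G) = (x_i x_j : {i, j} ∈ E(G))` in the polynomial ring `K[x_i : i ∈ V]`. -/
noncomputable def edgeIdeal {V : Type*} (K : Type*) [Field K] (G : SimpleGraph V) : Ideal (MvPolynomial V K) :=
  Ideal.span {f | ∃ i j : V, G.Adj i j ∧ f = MvPolynomial.X i * MvPolynomial.X j}

/-- The adjacency relation after adding a whisker at every vertex of `G`: `Sum.inl v` is the
original vertex `v`, and `Sum.inr v` is the new vertex, joined to `v` only. -/
def whiskerAdj {V : Type*} (G : SimpleGraph V) : V ⊕ V → V ⊕ V → Prop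
  | Sum.inl u, Sum.inl v => G.Adj u v
  | Sum.inl u, Sum.inr v => u = v
  | Sum.inr u, Sum.inl v => u = v
  | Sum.inr _, Sum.inr _ => False

/-- The graph obtained from `G` by adding a whisker at every vertex: for each vertex `v` of `G`
one new vertex and one edge from it to `v`. -/
def whisker {V : Type*} (G : SimpleGraph V) : SimpleGraph (V ⊕ V) where
  Adj := whiskerAdj G
  symm := ⟨by
    rintro (u | u) (v | v) h
    · exact SimpleGraph.Adj.symm h
    · exact Eq.symm h
    · exact Eq.symm h
    · exact h⟩
  loopless := ⟨by
    rintro (u | u) h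
    · exact G.irrefl h
    · exact h⟩

end SimpleGraph

/-- The depth of a local ring `R`: the supremum of the lengths of the `R`-regular sequences in
its maximal ideal. -/
noncomputable def localDepth (R : Type*) [CommRing R] [IsLocalRing R] : ℕ∞ :=
  ⨆ (rs : List R) (_ : (∀ r ∈ rs, r ∈ IsLocalRing.maximalIdeal R) ∧
    RingTheory.Sequence.IsRegular R rs), (rs.length : ℕ∞)

/-- A commutative ring is Cohen–Macaulay if it is Noetherian and each of its localizations `R_m`
at a maximal ideal `m` satisfies `depth R_m = dim R_m`. -/
structure IsCohenMacaulayRing (R : Type*) [CommRing R] : Prop where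
  isNoetherianRing : IsNoetherianRing R
  depth_eq_dim : ∀ (m : Ideal R) [m.IsMaximal],
    (localDepth (Localization.AtPrime m) : WithBot ℕ∞) = ringKrullDim (Localization.AtPrime m)

section

open RingTheory.Sequence

/-! The sums `x_v + y_v` make the quotient ring a finite free module over `A = K[X_v : v ∈ V]`, with
basis the monomials `x_W` for `W` independent (`basis`). A ring `R` finite and flat over `A` is
Cohen–Macaulay (`isCohenMacaulayRing_of_finite_of_flat`): at a maximal ideal `m`, the minimal
polynomials over `K` of the residues of the `X_v` give a regular sequence of length `|V|` in `A`.
Flatness carries it to `R_m`, while `dim R_m ≤ dim R ≤ dim A = |V|`. -/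

lemma RingEquiv.isWeaklyRegular_map {A B : Type*} [CommRing A] [CommRing B] (φ : A ≃+* B)
    {rs : List A} (h : IsWeaklyRegular A rs) : IsWeaklyRegular B (rs.map φ) :=
  (φ.toAddEquiv.isWeaklyRegular_congr <| List.forall₂_map_right_iff.mpr <|
    List.forall₂_same.mpr fun r _ x => by simp).mp h

/-- Prepending a monic polynomial to a weakly regular sequence of constants. -/
lemma Polynomial.Monic.isWeaklyRegular_cons_map_C {B : Type*} [CommRing B] {p : Polynomial B}
    (hp : p.Monic) {rs : List B} (h : IsWeaklyRegular B rs) :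
    IsWeaklyRegular (Polynomial B) (p :: rs.map Polynomial.C) := by
  refine (isWeaklyRegular_cons_iff _ _ _).mpr ⟨?_, ?_⟩
  · rw [isSMulRegular_iff_right_eq_zero_of_smul]
    intro q hq
    exact hp.mul_right_eq_zero_iff.mp hq
  · have hfree := hp.free_quotient
    have e : (Polynomial B ⧸ Ideal.span {p}) ≃ₗ[Polynomial B] QuotSMulTop p (Polynomial B) :=
      Submodule.quotEquivOfEq _ _ (by
        rw [← Submodule.ideal_span_singleton_smul]; simp)
    rw [← e.isWeaklyRegular_congr]
    refine (isWeaklyRegular_map_algebraMap_iff (S := Polynomial B) _ rs).mpr ?_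
    have := h.of_flat (S := Polynomial B ⧸ Ideal.span {p})
    exact (isWeaklyRegular_map_algebraMap_iff _ _ _).mp this

/-- Monic polynomials, one in each variable, form a weakly regular sequence. -/
lemma MvPolynomial.exists_isWeaklyRegular_aeval_X (K : Type*) [CommRing K] {σ : Type*} [Finite σ]
    (f : σ → Polynomial K) (hf : ∀ i, (f i).Monic) :
    ∃ rs : List (MvPolynomial σ K), rs.length = Nat.card σ ∧ IsWeaklyRegular (MvPolynomial σ K) rs ∧
      ∀ r ∈ rs, ∃ i, r = Polynomial.aeval (X i) (f i) := by
  induction σ using Finite.induction_empty_option with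
  | of_equiv e ih =>
    obtain ⟨rs, hlen, hreg, hmem⟩ := ih (fun i => f (e i)) (fun i => hf _)
    refine ⟨rs.map (renameEquiv K e), by simp [hlen, Nat.card_congr e],
      (renameEquiv K e).toRingEquiv.isWeaklyRegular_map hreg, fun r hr => ?_⟩
    obtain ⟨s, hs, rfl⟩ := List.mem_map.mp hr
    obtain ⟨i, rfl⟩ := hmem s hs
    exact ⟨e i, by rw [← Polynomial.aeval_algHom_apply]; simp⟩
  | h_empty => exact ⟨[], by simp⟩
  | @h_option σ _ ih =>
    obtain ⟨rs, hlen, hreg, hmem⟩ := ih (fun i => f (some i)) (fun i => hf _)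
    have hp := (hf none).map (algebraMap K (MvPolynomial σ K))
    refine ⟨(_ :: rs.map Polynomial.C).map (optionEquivLeft K σ).symm, ?_,
      (optionEquivLeft K σ).symm.toRingEquiv.isWeaklyRegular_map
        (hp.isWeaklyRegular_cons_map_C hreg), fun r hr => ?_⟩
    · simp [hlen]
    · obtain ⟨s, hs, rfl⟩ := List.mem_map.mp hr
      obtain rfl | hs := List.mem_cons.mp hs
      · refine ⟨none, (optionEquivLeft K σ).injective ?_⟩
        rw [← Polynomial.aeval_algHom_apply]
        simp [optionEquivLeft_X_none, Polynomial.aeval_X_left_eq_map]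
      · obtain ⟨t, ht, rfl⟩ := List.mem_map.mp hs
        obtain ⟨i, rfl⟩ := hmem t ht
        refine ⟨some i, (optionEquivLeft K σ).injective ?_⟩
        have h := Polynomial.aeval_algebraMap_apply (Polynomial (MvPolynomial σ K))
          (X i : MvPolynomial σ K) (f (some i))
        rw [Polynomial.algebraMap_eq] at h
        rw [← Polynomial.aeval_algHom_apply (optionEquivLeft K σ)]
        simp [optionEquivLeft_X_some, h]

/-- Incomparability: a strict chain of primes contracts to a strict chain. -/
lemma ringKrullDim_le_of_isIntegral (A B : Type*) [CommRing A] [CommRing B] [Algebra A B]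
    [Algebra.IsIntegral A B] : ringKrullDim B ≤ ringKrullDim A :=
  Order.krullDim_le_of_strictMono (PrimeSpectrum.comap (algebraMap A B)) fun _ _ h =>
    Ideal.IsIntegral.comap_lt_comap h

lemma localDepth_le_ringKrullDim (R : Type*) [CommRing R] [IsLocalRing R] [IsNoetherianRing R] :
    (localDepth R : WithBot ℕ∞) ≤ ringKrullDim R := by
  obtain ⟨d, hd⟩ : ∃ d : ℕ∞, ringKrullDim R = d :=
    ⟨_, (WithBot.coe_unbot _ ringKrullDim_ne_bot).symm⟩
  rw [hd, WithBot.coe_le_coe]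
  refine iSup₂_le fun rs h => ?_
  rw [← WithBot.coe_le_coe, ← hd, ← ringKrullDim_add_length_eq_ringKrullDim_of_isRegular rs h.2]
  have : Nontrivial (R ⧸ Ideal.ofList rs) := by
    refine Ideal.Quotient.nontrivial_iff.mpr fun h' => h.2.2 ?_
    simp [h']
  exact le_add_of_nonneg_left ringKrullDim_nonneg_of_nontrivial

/-- An algebra that is finite and flat over a polynomial ring over a field is Cohen–Macaulay. -/
theorem isCohenMacaulayRing_of_finite_of_flat (K : Type*) [Field K] {σ : Type*} [Finite σ]
    (R : Type*) [CommRing R] [Algebra K R] [Algebra (MvPolynomial σ K) R]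
    [IsScalarTower K (MvPolynomial σ K) R] [Module.Finite (MvPolynomial σ K) R]
    [Module.Flat (MvPolynomial σ K) R] : IsCohenMacaulayRing R := by
  have hN : IsNoetherianRing R := .of_finite (MvPolynomial σ K) R
  refine ⟨hN, fun m hm => ?_⟩
  have : Algebra.FiniteType K R := .trans
    (inferInstance : Algebra.FiniteType K (MvPolynomial σ K)) inferInstance
  refine le_antisymm (localDepth_le_ringKrullDim _) ?_
  let := Ideal.Quotient.field m
  -- Zariski's lemma; it makes the residues of the variables algebraic over `K`.
  have : Module.Finite K (R ⧸ m) := finite_of_finite_type_of_isJacobsonRing K (R ⧸ m)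
  let t (i : σ) : R := algebraMap (MvPolynomial σ K) R (.X i)
  have hint (i : σ) : IsIntegral K (Ideal.Quotient.mk m (t i)) := .of_finite _ _
  obtain ⟨rs, hlen, hreg, hmem⟩ := MvPolynomial.exists_isWeaklyRegular_aeval_X K
    (fun i => minpoly K (Ideal.Quotient.mk m (t i))) (fun i => minpoly.monic (hint i))
  have hreg' := (hreg.of_flat (S := R)).isRegular_of_isLocalization_of_mem
    (Localization.AtPrime m) m (fun r hr => by
      obtain ⟨s, hs, rfl⟩ := List.mem_map.mp hr
      obtain ⟨i, rfl⟩ := hmem s hs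
      rw [← Polynomial.aeval_algebraMap_apply, ← Ideal.Quotient.eq_zero_iff_mem,
        ← Ideal.Quotient.mkₐ_eq_mk K, ← Polynomial.aeval_algHom_apply]
      exact minpoly.aeval K _)
  calc ringKrullDim (Localization.AtPrime m) = m.height :=
        IsLocalization.AtPrime.ringKrullDim_eq_height m _
    _ ≤ ringKrullDim R := Ideal.height_le_ringKrullDim_of_ne_top hm.ne_top
    _ ≤ ringKrullDim (MvPolynomial σ K) := ringKrullDim_le_of_isIntegral _ _
    _ = ((Nat.card σ : ℕ∞) : WithBot ℕ∞) := by
        rw [MvPolynomial.ringKrullDim_of_isNoetherianRing, ringKrullDim_eq_zero_of_field]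
        simp
    _ ≤ localDepth (Localization.AtPrime m) := by
        rw [WithBot.coe_le_coe]
        refine le_trans ?_ (le_iSup₂ _ ⟨fun r hr => ?_, hreg'⟩)
        · simp [hlen]
        · by_contra hu
          refine hreg'.2 (Eq.symm ?_)
          rw [smul_eq_mul, Ideal.mul_top]
          exact Ideal.eq_top_of_isUnit_mem _ (Ideal.subset_span hr) (by simpa using hu)

end

/-! ### Freeness of the whisker ring over its parameters -/

namespace SimpleGraph
open MvPolynomial

variable {V : Type*} (K : Type*) [Field K] (G : SimpleGraph V)

/-- The quotient of the polynomial ring by the edge ideal of the whiskered graph. -/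
abbrev WhiskerRing : Type _ := MvPolynomial (V ⊕ V) K ⧸ edgeIdeal K G.whisker

namespace WhiskerRing

/-- The class of the variable of an original vertex. -/
noncomputable def x (v : V) : WhiskerRing K G := Ideal.Quotient.mk _ (X (Sum.inl v))

/-- The class of the variable of a whisker. -/
noncomputable def y (v : V) : WhiskerRing K G := Ideal.Quotient.mk _ (X (Sum.inr v))

variable {G} in
lemma x_mul_x_of_adj {u v : V} (h : G.Adj u v) : x K G u * x K G v = 0 := by
  rw [x, x, ← map_mul, Ideal.Quotient.eq_zero_iff_mem]
  exact Ideal.subset_span ⟨Sum.inl u, Sum.inl v, h, rfl⟩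

lemma x_mul_y (v : V) : x K G v * y K G v = 0 := by
  rw [x, y, ← map_mul, Ideal.Quotient.eq_zero_iff_mem]
  exact Ideal.subset_span ⟨Sum.inl v, Sum.inr v, rfl, rfl⟩

/-- The parameters `x_v + y_v` make the ring an algebra over the polynomial ring in `V`. -/
noncomputable def paramHom : MvPolynomial V K →ₐ[K] WhiskerRing K G :=
  aeval fun v => x K G v + y K G v

noncomputable instance : Algebra (MvPolynomial V K) (WhiskerRing K G) :=
  (paramHom K G).toRingHom.toAlgebra

noncomputable instance : Module (MvPolynomial V K) (WhiskerRing K G) := Algebra.toModule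

lemma algebraMap_X (v : V) :
    algebraMap (MvPolynomial V K) (WhiskerRing K G) (X v) = x K G v + y K G v :=
  aeval_X _ v

instance : IsScalarTower K (MvPolynomial V K) (WhiskerRing K G) :=
  .of_algebraMap_eq fun r => ((paramHom K G).commutes r).symm

open Classical in
variable {G} in
/-- Restriction to the component of an independent set `U`: `x_v` survives exactly when `v ∈ U`,
`y_v` exactly when `v ∉ U`. -/
noncomputable def evalIndep {U : Set V} (hU : G.IsIndepSet U) :
    WhiskerRing K G →+* MvPolynomial V K :=
  Ideal.Quotient.lift _
    (aeval (R := K) (Sum.elim (fun v => if v ∈ U then X v else 0)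
      (fun v => if v ∈ U then 0 else X v))).toRingHom (by
    intro a ha
    rw [← RingHom.mem_ker]
    refine (Ideal.span_le.mpr ?_ : edgeIdeal K G.whisker ≤ _) ha
    rintro _ ⟨i | i, j | j, h, rfl⟩
    · have : ¬ (i ∈ U ∧ j ∈ U) := fun ⟨hi, hj⟩ => hU hi hj (SimpleGraph.Adj.ne h) h
      simp only [SetLike.mem_coe, RingHom.mem_ker]
      by_cases hi : i ∈ U <;> simp_all
    · obtain rfl : i = j := h
      by_cases hi : i ∈ U <;> simp [hi]
    · obtain rfl : i = j := h
      by_cases hi : i ∈ U <;> simp [hi]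
    · exact h.elim)

section
open Classical
variable {G} {U : Set V} (hU : G.IsIndepSet U)

lemma evalIndep_x (v : V) : evalIndep K hU (x K G v) = if v ∈ U then X v else 0 := by
  simp [evalIndep, x]

lemma evalIndep_y (v : V) : evalIndep K hU (y K G v) = if v ∈ U then 0 else X v := by
  simp [evalIndep, y]

/-- Exactly one of `x_v`, `y_v` survives, so `x_v + y_v` always maps to `X v`. -/
lemma evalIndep_smul (p : MvPolynomial V K) (r : WhiskerRing K G) :
    evalIndep K hU (p • r) = p * evalIndep K hU r := by
  rw [Algebra.smul_def, map_mul]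
  congr 1
  induction p using MvPolynomial.induction_on with
  | C a =>
    have : algebraMap (MvPolynomial V K) (WhiskerRing K G) (C a) =
        Ideal.Quotient.mk _ (C a) := (paramHom K G).commutes a
    rw [this]
    simp [evalIndep, MvPolynomial.algebraMap_eq]
  | add p q hp hq => rw [map_add, map_add, hp, hq]
  | mul_X p v hp =>
    rw [map_mul, map_mul, hp, algebraMap_X, map_add, evalIndep_x, evalIndep_y]
    split_ifs <;> simp

end

/-- The squarefree monomial `x_W`. -/
noncomputable def xProd (W : Finset V) : WhiskerRing K G := ∏ v ∈ W, x K G v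

lemma xProd_eq_zero {W : Finset V} (hW : ¬ G.IsIndepSet (W : Set V)) : xProd K G W = 0 := by
  classical
  simp only [SimpleGraph.IsIndepSet, Set.Pairwise, not_forall, not_not] at hW
  obtain ⟨u, hu, v, hv, hne, hadj⟩ := hW
  rw [xProd, ← Finset.mul_prod_erase W _ hu,
    ← Finset.mul_prod_erase (W.erase u) _ (Finset.mem_erase.mpr ⟨hne.symm, hv⟩), ← mul_assoc,
    x_mul_x_of_adj K hadj, zero_mul]

/-- Since `x_v y_v = 0`, `x_v ^ 2 = (x_v + y_v) x_v`: squares are absorbed into the scalars. -/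
lemma x_mul_xProd [DecidableEq V] (v : V) (W : Finset V) :
    x K G v * xProd K G W = if v ∈ W then (X v : MvPolynomial V K) • xProd K G W
      else xProd K G (insert v W) := by
  split_ifs with h
  · rw [Algebra.smul_def, algebraMap_X, xProd, ← Finset.mul_prod_erase W _ h]
    linear_combination -(∏ v ∈ W.erase v, x K G v) * x_mul_y K G v
  · rw [xProd, xProd, Finset.prod_insert h]

/-- The span contains `1` and is stable under each `x_v`, hence under `y_v = (x_v + y_v) - x_v`. -/
lemma span_range_xProd : Submodule.span (MvPolynomial V K) (Set.range (xProd K G)) = ⊤ := by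
  classical
  set N := Submodule.span (MvPolynomial V K) (Set.range (xProd K G)) with hN
  have hx (v : V) (r : WhiskerRing K G) (hr : r ∈ N) : x K G v * r ∈ N := by
    induction hr using Submodule.span_induction with
    | mem r h =>
      obtain ⟨W, rfl⟩ := h
      rw [x_mul_xProd]
      split_ifs
      · exact N.smul_mem _ (Submodule.subset_span ⟨_, rfl⟩)
      · exact Submodule.subset_span ⟨_, rfl⟩
    | zero => simp
    | add a b _ _ ha hb => rw [mul_add]; exact N.add_mem ha hb
    | smul p a _ ha => rw [mul_smul_comm]; exact N.smul_mem _ ha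
  have hy (v : V) (r : WhiskerRing K G) (hr : r ∈ N) : y K G v * r ∈ N := by
    have : y K G v * r = (X v : MvPolynomial V K) • r - x K G v * r := by
      rw [Algebra.smul_def, algebraMap_X]; ring
    rw [this]
    exact N.sub_mem (N.smul_mem _ hr) (hx v r hr)
  refine Submodule.eq_top_iff'.mpr fun r => ?_
  obtain ⟨p, rfl⟩ := Ideal.Quotient.mk_surjective r
  induction p using MvPolynomial.induction_on with
  | C a =>
    have h : (C a : MvPolynomial V K) • xProd K G ∅ = Ideal.Quotient.mk _ (C a) := by
      rw [Algebra.smul_def, xProd, Finset.prod_empty, mul_one]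
      exact (paramHom K G).commutes a
    rw [← h]
    exact N.smul_mem _ (Submodule.subset_span ⟨_, rfl⟩)
  | add p q hp hq => rw [map_add]; exact N.add_mem hp hq
  | mul_X p i hp =>
    rw [map_mul, mul_comm]
    obtain v | v := i
    · exact hx v _ hp
    · exact hy v _ hp

open Classical in
lemma evalIndep_xProd {U : Set V} (hU : G.IsIndepSet U) (W : Finset V) :
    evalIndep K hU (xProd K G W) = if (W : Set V) ⊆ U then ∏ v ∈ W, X v else 0 := by
  rw [xProd, map_prod]
  simp only [evalIndep_x]
  split_ifs with h
  · exact Finset.prod_congr rfl fun v hv => if_pos (h hv)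
  · obtain ⟨v, hv, hvU⟩ := Set.not_subset.mp h
    exact Finset.prod_eq_zero hv (if_neg hvU)

/-- Evaluation at `W` kills `x_W'` unless `W' ⊆ W`. Proper subsets have zero coefficient by
induction, so `a_W` times a nonzero monomial vanishes in a domain. -/
lemma linearIndependent_xProd : LinearIndependent (MvPolynomial V K)
    fun W : {W : Finset V // G.IsIndepSet (W : Set V)} => xProd K G W := by
  classical
  rw [linearIndependent_iff']
  intro s a hsum
  suffices h : ∀ (W : Finset V) (hW : G.IsIndepSet (W : Set V)), ⟨W, hW⟩ ∈ s → a ⟨W, hW⟩ = 0 from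
    fun W hW => h W.1 W.2 hW
  intro W
  induction W using Finset.strongInduction with
  | H W ih =>
    intro hW hs
    have h := congrArg (evalIndep K hW) hsum
    rw [map_sum, map_zero, Finset.sum_eq_single_of_mem ⟨W, hW⟩ hs, evalIndep_smul,
      evalIndep_xProd, if_pos subset_rfl] at h
    · exact (mul_eq_zero.mp h).resolve_right (Finset.prod_ne_zero_iff.mpr fun v _ => X_ne_zero v)
    · intro W' hs' hne
      rw [evalIndep_smul, evalIndep_xProd]
      split_ifs with hsub
      · rw [ih W'.1 ((Finset.coe_subset.mp hsub).ssubset_of_ne fun h => hne (Subtype.ext h))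
          W'.2 hs', zero_mul]
      · rw [mul_zero]

/-- The monomials `x_W`, for `W` independent, form a basis over the ring of parameters. -/
noncomputable def basis : Module.Basis {W : Finset V // G.IsIndepSet (W : Set V)}
    (MvPolynomial V K) (WhiskerRing K G) :=
  .mk (linearIndependent_xProd K G) <| by
    rw [← span_range_xProd, Submodule.span_le]
    rintro _ ⟨W, rfl⟩
    by_cases hW : G.IsIndepSet (W : Set V)
    · exact Submodule.subset_span ⟨⟨W, hW⟩, rfl⟩
    · rw [xProd_eq_zero K G hW]
      exact zero_mem _

end WhiskerRing

end SimpleGraph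

theorem corollary2p6 {V : Type*} [Finite V] (K : Type*) [Field K] (G : SimpleGraph V) :
    IsCohenMacaulayRing (MvPolynomial (V ⊕ V) K ⧸ SimpleGraph.edgeIdeal K G.whisker) := by
  have : Module.Free (MvPolynomial V K) (SimpleGraph.WhiskerRing K G) :=
    .of_basis (SimpleGraph.WhiskerRing.basis K G)
  have : Module.Finite (MvPolynomial V K) (SimpleGraph.WhiskerRing K G) :=
    .of_basis (SimpleGraph.WhiskerRing.basis K G)
  exact isCohenMacaulayRing_of_finite_of_flat K (σ := V) (SimpleGraph.WhiskerRing K G)
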